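/- Let $\mathcal M_d$ denote the complex $d\times d$ matrices; "positive" means positive semidefinite. For $\psi\in\mathbb C^{a}\otimes\mathbb C^{b}$ let the Schmidt rank be $\mathrm{SR}(\psi)=\mathrm{rk}\big((\mathrm{id}_a\otimes\mathrm{tr})(|\psi\rangle\langle\psi|)\big)$. The Schmidt number $\mathrm{SN}(X)$ of a positive matrix $X\in\mathcal M_a\otimes\mathcal M_b$ is the least integer $m\ge 1$ such that $X=\sum_{i=1}^{r}|\psi_i\rangle\langle\psi_i|$ for finitely many vectors $\psi_i\in\mathbb C^a\otimes\mathbb C^b$ with $\mathrm{SR}(\psi_i)\le m$. A matrix $X\in\mathcal M_a\otimes\mathcal M_b$ is separable if it is a finite sum $\sum_i A_i\otimes B_i$ with $A_i\in\mathcal M_a$ and $B_i\in\mathcal M_b$ positive. A linear map $T:\mathcal M_{d_1}\to\mathcal M_{d_2}$ is $k$-positive if $(\mathrm{id}_k\otimes T)(X)$ is positive for every positive $X\in\mathcal M_k\otimes\mathcal M_{d_1}$. A $k$-positive map $T$ is $n$-entanglement breaking (for some $n\le k$) if $(\mathrm{id}_n\otimes T)(X)$ is separable for every positive $X\in\mathcal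 M_n\otimes\mathcal M_{d_1}$. **Lemma (Schmidt number trimming).** Let $T:\mathcal M_{d_1}\to\mathcal M_{d_2}$ be a $k$-positive linear map and let $n\le\min(k,d_2)$. Then $T$ is $n$-entanglement breaking if and only if, for every $l\le\min(k,d_2)$ and every positive $X\in\mathcal M_l\otimes\mathcal M_{d_1}$, $$\mathrm{SN}\big((\mathrm{id}_l\otimes T)(X)\big)\le\max(l-n+1,\,1).$$ -/

import Mathlib

open scoped Kronecker ComplexOrder

namespace QInfo

/-- The linear map `id_n ⊗ T : M_n ⊗ M_{d₁} → M_n ⊗ M_{d₂}`, where `M_n ⊗ M_d` is identified with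
the matrices indexed by `Fin n × Fin d`: `T` is applied to each of the `n²` blocks. -/
def idTensor {d₁ d₂ : ℕ} (n : ℕ)
    (T : Matrix (Fin d₁) (Fin d₁) ℂ →ₗ[ℂ] Matrix (Fin d₂) (Fin d₂) ℂ) :
    Matrix (Fin n × Fin d₁) (Fin n × Fin d₁) ℂ →ₗ[ℂ]
      Matrix (Fin n × Fin d₂) (Fin n × Fin d₂) ℂ where
  toFun X := Matrix.of fun p q => T (Matrix.of fun a b => X (p.1, a) (q.1, b)) p.2 q.2
  map_add' X Y := by
    ext p q
    exact congrFun (congrFun (T.map_add (Matrix.of fun a b => X (p.1, a) (q.1, b))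
      (Matrix.of fun a b => Y (p.1, a) (q.1, b))) p.2) q.2
  map_smul' c X := by
    ext p q
    exact congrFun (congrFun (T.map_smul c (Matrix.of fun a b => X (p.1, a) (q.1, b))) p.2) q.2

/-- On product matrices, `(id_n ⊗ T)(A ⊗ B) = A ⊗ T(B)`. -/
theorem idTensor_kronecker {d₁ d₂ n : ℕ}
    (T : Matrix (Fin d₁) (Fin d₁) ℂ →ₗ[ℂ] Matrix (Fin d₂) (Fin d₂) ℂ)
    (A : Matrix (Fin n) (Fin n) ℂ) (B : Matrix (Fin d₁) (Fin d₁) ℂ) :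
    idTensor n T (A ⊗ₖ B) = A ⊗ₖ T B := by
  ext p q
  exact congrFun (congrFun (T.map_smul (A p.1 q.1) B) p.2) q.2

/-- `T` is `k`-positive: `id_k ⊗ T` maps positive (semidefinite) matrices to positive matrices. -/
def IsKPositive {d₁ d₂ : ℕ} (k : ℕ)
    (T : Matrix (Fin d₁) (Fin d₁) ℂ →ₗ[ℂ] Matrix (Fin d₂) (Fin d₂) ℂ) : Prop :=
  ∀ X : Matrix (Fin k × Fin d₁) (Fin k × Fin d₁) ℂ, X.PosSemidef → (idTensor k T X).PosSemidef

/-- `X` is separable: it belongs to the convex cone generated by the product matrices `A ⊗ B` with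
`A` and `B` positive. Nonnegative coefficients are absorbed into the `A i`. -/
def IsSeparable {d₁ d₂ : ℕ} (X : Matrix (Fin d₁ × Fin d₂) (Fin d₁ × Fin d₂) ℂ) : Prop :=
  ∃ (m : ℕ) (A : Fin m → Matrix (Fin d₁) (Fin d₁) ℂ) (B : Fin m → Matrix (Fin d₂) (Fin d₂) ℂ),
    (∀ i, (A i).PosSemidef) ∧ (∀ i, (B i).PosSemidef) ∧ X = ∑ i, A i ⊗ₖ B i

/-- `T` is `n`-entanglement breaking: `(id_n ⊗ T)(X)` is separable for every positive `X`. -/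
def IsEntanglementBreaking {d₁ d₂ : ℕ} (n : ℕ)
    (T : Matrix (Fin d₁) (Fin d₁) ℂ →ₗ[ℂ] Matrix (Fin d₂) (Fin d₂) ℂ) : Prop :=
  ∀ X : Matrix (Fin n × Fin d₁) (Fin n × Fin d₁) ℂ, X.PosSemidef → IsSeparable (idTensor n T X)

/-- The rank-one matrix `|ψ⟩⟨ψ|`. -/
def proj {ι : Type*} (ψ : ι → ℂ) : Matrix ι ι ℂ :=
  Matrix.vecMulVec ψ (star ψ)

/-- The partial trace `id_{d₁} ⊗ tr` over the second tensor factor. -/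
def partialTraceRight {d₁ d₂ : ℕ} (X : Matrix (Fin d₁ × Fin d₂) (Fin d₁ × Fin d₂) ℂ) :
    Matrix (Fin d₁) (Fin d₁) ℂ :=
  Matrix.of fun i j => ∑ a, X (i, a) (j, a)

/-- The Schmidt rank `rk ((id ⊗ tr)(|ψ⟩⟨ψ|))` of `ψ ∈ ℂ^{d₁} ⊗ ℂ^{d₂}`. -/
noncomputable def schmidtRank {d₁ d₂ : ℕ} (ψ : Fin d₁ × Fin d₂ → ℂ) : ℕ :=
  (partialTraceRight (proj ψ)).rank

/-- `X` is a finite sum of matrices `|ψ⟩⟨ψ|` with `ψ` of Schmidt rank at most `k`. -/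
def HasSchmidtDecomposition {d₁ d₂ : ℕ} (k : ℕ)
    (X : Matrix (Fin d₁ × Fin d₂) (Fin d₁ × Fin d₂) ℂ) : Prop :=
  ∃ (m : ℕ) (ψ : Fin m → Fin d₁ × Fin d₂ → ℂ),
    (∀ i, schmidtRank (ψ i) ≤ k) ∧ X = ∑ i, proj (ψ i)

/-- The Schmidt number of a positive matrix `X`: the least positive integer `k` such that `X` is a
finite sum of matrices `|ψ⟩⟨ψ|` with `ψ` of Schmidt rank at most `k`. -/
noncomputable def schmidtNumber {d₁ d₂ : ℕ}
    (X : Matrix (Fin d₁ × Fin d₂) (Fin d₁ × Fin d₂) ℂ) : ℕ :=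
  sInf {k : ℕ | 1 ≤ k ∧ HasSchmidtDecomposition k X}

/-- For a positive matrix the minimum in the definition of the Schmidt number is attained, so that
`schmidtNumber` takes no default value there. -/
theorem schmidtNumber_spec {d₁ d₂ : ℕ} {X : Matrix (Fin d₁ × Fin d₂) (Fin d₁ × Fin d₂) ℂ}
    (hX : X.PosSemidef) : 1 ≤ schmidtNumber X ∧ HasSchmidtDecomposition (schmidtNumber X) X := by
  have hne : {k : ℕ | 1 ≤ k ∧ HasSchmidtDecomposition k X}.Nonempty := by
    obtain ⟨m, ψ, h⟩ := Matrix.posSemidef_iff_eq_sum_vecMulVec.mp hX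
    refine ⟨d₁ + 1, by omega, m, ψ, fun i => ?_, h⟩
    have := Matrix.rank_le_card_height (partialTraceRight (proj (ψ i)))
    rw [Fintype.card_fin] at this
    exact this.trans (Nat.le_succ d₁)
  exact Nat.sInf_mem hne

end QInfo

/-!
The heart of the matter is a generalized Schur complement. Suppose that `T` is `k`-positive and
`n`-entanglement breaking, let `X` be positive on `ℂ^l ⊗ ℂ^{d₁}` with `n ≤ l ≤ k`, and put
`Y = (id_l ⊗ T)(X)`, which is positive. The corner of `Y` on the first `n` basis vectors of `ℂ^l`
is `(id_n ⊗ T)` of the corresponding corner of `X`, hence separable, hence a sum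
`∑ᵢ |aᵢ ⊗ bᵢ⟩⟨aᵢ ⊗ bᵢ|`.

Any such rank-one decomposition of a corner of a positive matrix extends to the whole matrix, up to
a positive remainder that vanishes on the corner (`exists_extend_sum_proj`). If `Y = Bᴴ * B` and `A`
consists of the columns of `B` in the corner, then the corner is `Aᴴ * A`, and another factorization
`Vᴴ * V` of it has the form `V = U * A` with a contraction `U` (`exists_contraction_of_gram_eq`); the
conjugated rows of `U * B` are the extended vectors, and the remainder is `Bᴴ * (1 - Uᴴ * U) * B`.

Here the extended vectors have the form `(aᵢ ⊗ bᵢ) ⊕ wᵢ` with `wᵢ ∈ ℂ^{l-n} ⊗ ℂ^{d₂}`, and the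
vectors of any rank-one decomposition of the remainder have the same form with `aᵢ ⊗ bᵢ = 0`; hence
all of them have Schmidt rank at most `1 + (l - n)` (`schmidtRank_le_of_corner_eq_mul`). The
case `l < n` is reduced to `n = l` by `IsEntanglementBreaking.mono`.

Conversely, the bound for `l = n` says that `(id_n ⊗ T)(X)` has Schmidt number `1`, and a vector of
Schmidt rank at most one is a product vector.
-/

open Matrix

namespace QInfo

/-! ### Rank-one decompositions -/

theorem proj_apply {ι : Type*} (ψ : ι → ℂ) (p q : ι) : proj ψ p q = ψ p * star (ψ q) := rfl

theorem posSemidef_proj {ι : Type*} [Finite ι] (ψ : ι → ℂ) : (proj ψ).PosSemidef :=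
  posSemidef_vecMulVec_self_star ψ

theorem _root_.Matrix.PosSemidef.exists_eq_sum_proj {ι : Type*} [Finite ι] {X : Matrix ι ι ℂ}
    (hX : X.PosSemidef) : ∃ (m : ℕ) (ψ : Fin m → ι → ℂ), X = ∑ i, proj (ψ i) :=
  posSemidef_iff_eq_sum_vecMulVec.mp hX

theorem sum_proj_eq_conjTranspose_mul_self {ι κ : Type*} [Fintype ι] (v : ι → κ → ℂ) :
    ∑ i, proj (v i) = (Matrix.of fun i p => star (v i p))ᴴ * Matrix.of fun i p => star (v i p) := by
  ext p q
  simp [Matrix.sum_apply, Matrix.mul_apply, proj_apply]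

theorem proj_kronecker_proj {ι κ : Type*} (a : ι → ℂ) (b : κ → ℂ) :
    proj a ⊗ₖ proj b = proj fun p : ι × κ => a p.1 * b p.2 := by
  ext p q
  simp only [kroneckerMap_apply, proj_apply, star_mul']
  ring

/-- A vector occurring in a rank-one decomposition vanishes wherever the diagonal of the matrix
does. -/
theorem apply_eq_zero_of_sum_proj_diag_eq_zero {ι κ : Type*} [Fintype ι] [Finite κ]
    (v : ι → κ → ℂ) {p : κ}
    (h : (∑ i, proj (v i)) p p = 0) (i : ι) : v i p = 0 := by
  rw [Matrix.sum_apply] at h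
  have h' := (Finset.sum_eq_zero_iff_of_nonneg
    (fun j _ => (posSemidef_proj (v j)).diag_nonneg (i := p))).mp h i (Finset.mem_univ i)
  simpa [proj_apply] using h'

/-! ### Extending a decomposition of a corner -/

/-- Linear maps `f`, `g` with `‖f x‖ = ‖g x‖` for all `x` differ by a contraction: `f x ↦ g x` is a
well defined isometry on the range of `f`, which is extended by zero on the orthogonal complement. -/
theorem exists_contraction_of_norm_eq {E F G : Type*} [AddCommGroup E] [Module ℂ E]
    [NormedAddCommGroup F] [InnerProductSpace ℂ F] [FiniteDimensional ℂ F]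
    [NormedAddCommGroup G] [NormedSpace ℂ G] (f : E →ₗ[ℂ] F) (g : E →ₗ[ℂ] G)
    (h : ∀ x, ‖f x‖ = ‖g x‖) : ∃ u : F →ₗ[ℂ] G, g = u ∘ₗ f ∧ ∀ y, ‖u y‖ ≤ ‖y‖ := by
  obtain ⟨s, hs⟩ := f.rangeRestrict.exists_rightInverse_of_surjective f.range_rangeRestrict
  have hs' : ∀ y, f (s y) = y := fun y => congrArg Subtype.val (LinearMap.congr_fun hs y)
  refine ⟨g ∘ₗ s ∘ₗ (LinearMap.range f).orthogonalProjectionOnto.toLinearMap,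
    LinearMap.ext fun x => ?_, fun y => ?_⟩
  · have hx : (LinearMap.range f).orthogonalProjectionOnto (f x) = ⟨f x, x, rfl⟩ :=
      Submodule.orthogonalProjectionOnto_mem_subspace_eq_self (⟨f x, x, rfl⟩ : LinearMap.range f)
    -- `x` and the preimage `s (f x)` have the same image under `f`, hence under `g`.
    have h0 : ‖g (x - s ⟨f x, x, rfl⟩)‖ = 0 := by
      rw [← h, map_sub, hs', sub_self, norm_zero]
    rw [norm_eq_zero, map_sub, sub_eq_zero] at h0
    simpa [hx] using h0
  · calc ‖g (s ((LinearMap.range f).orthogonalProjectionOnto y))‖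
        = ‖(LinearMap.range f).orthogonalProjectionOnto y‖ := by rw [← h, hs', Submodule.coe_norm]
      _ ≤ ‖y‖ := Submodule.norm_orthogonalProjectionOnto_apply_le _ y

theorem norm_sq_toEuclideanLin {m n : Type*} [Fintype m] [Fintype n] [DecidableEq n]
    (A : Matrix m n ℂ) (x : EuclideanSpace ℂ n) :
    ((‖toEuclideanLin A x‖ ^ 2 : ℝ) : ℂ) = star x.ofLp ⬝ᵥ ((Aᴴ * A) *ᵥ x.ofLp) := by
  have := inner_self_eq_norm_sq_to_K (𝕜 := ℂ) (toEuclideanLin A x)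
  rw [EuclideanSpace.inner_eq_star_dotProduct, dotProduct_comm] at this
  rw [Complex.ofReal_pow, ← mulVec_mulVec, dotProduct_mulVec, ← star_mulVec]
  exact this.symm

/-- Two factorizations of the same Gram matrix differ by a contraction. -/
theorem exists_contraction_of_gram_eq {m r κ : Type*} [Fintype m] [Fintype r] [Fintype κ]
    [DecidableEq m] (A : Matrix m κ ℂ) (V : Matrix r κ ℂ) (h : Aᴴ * A = Vᴴ * V) :
    ∃ U : Matrix r m ℂ, V = U * A ∧ (1 - Uᴴ * U).PosSemidef := by
  classical
  obtain ⟨u, hu, hle⟩ := exists_contraction_of_norm_eq (toEuclideanLin A)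
    (toEuclideanLin V) fun x => by
    have hx : ((‖toEuclideanLin A x‖ ^ 2 : ℝ) : ℂ) = ((‖toEuclideanLin V x‖ ^ 2 : ℝ) : ℂ) := by
      rw [norm_sq_toEuclideanLin, norm_sq_toEuclideanLin, h]
    exact (sq_eq_sq₀ (norm_nonneg _) (norm_nonneg _)).mp (Complex.ofReal_injective hx)
  obtain ⟨U, rfl⟩ := toEuclideanLin.surjective u
  refine ⟨U, ?_, .of_dotProduct_mulVec_nonneg
    (isHermitian_one.sub (isHermitian_conjTranspose_mul_self U)) fun x => ?_⟩
  · refine ext_of_mulVec_single fun j => ?_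
    rw [← mulVec_mulVec]
    exact congrArg WithLp.ofLp (LinearMap.congr_fun hu (WithLp.toLp 2 (Pi.single j 1)))
  · have hx := hle (WithLp.toLp 2 x)
    have hU := norm_sq_toEuclideanLin U (WithLp.toLp 2 x)
    have h1 := norm_sq_toEuclideanLin (1 : Matrix m m ℂ) (WithLp.toLp 2 x)
    rw [conjTranspose_one, Matrix.one_mul] at h1
    have h1' : toEuclideanLin (1 : Matrix m m ℂ) (WithLp.toLp 2 x) = WithLp.toLp 2 x := by
      simp
    rw [h1'] at h1
    rw [sub_mulVec, dotProduct_sub, ← hU, ← h1, ← Complex.ofReal_sub, Complex.zero_le_real,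
      sub_nonneg]
    gcongr

/-- A rank-one decomposition of a corner of a positive matrix extends to a rank-one decomposition of
the whole matrix, up to a positive remainder (whose corner is then zero). -/
theorem exists_extend_sum_proj {ι κ r : Type*} [Fintype ι] [Fintype κ] [Fintype r]
    {Y : Matrix ι ι ℂ} (hY : Y.PosSemidef) (f : κ → ι) (v : r → κ → ℂ)
    (hv : Y.submatrix f f = ∑ i, proj (v i)) :
    ∃ w : r → ι → ℂ, (∀ i p, w i (f p) = v i p) ∧ (Y - ∑ i, proj (w i)).PosSemidef := by
  classical
  obtain ⟨m, ψ, hψ⟩ := hY.exists_eq_sum_proj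
  rw [sum_proj_eq_conjTranspose_mul_self] at hψ hv
  set B : Matrix (Fin m) ι ℂ := Matrix.of fun i p => star (ψ i p)
  obtain ⟨U, hU, hpos⟩ := exists_contraction_of_gram_eq (B.submatrix id f) _
    (by rw [← hv, hψ]; rfl)
  refine ⟨fun i p => star ((U * B) i p), fun i p => ?_, ?_⟩
  · have := congrFun (congrFun hU i) p
    simp only [of_apply] at this
    rw [← star_star (v i p), this]
    rfl
  · have := hpos.conjTranspose_mul_mul_same B
    rw [sum_proj_eq_conjTranspose_mul_self, hψ]
    simp only [star_star]
    convert this using 1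
    change _ - (U * B)ᴴ * (U * B) = _
    rw [Matrix.mul_sub, Matrix.sub_mul, Matrix.mul_one, conjTranspose_mul]
    simp only [Matrix.mul_assoc]

/-! ### Schmidt rank and Schmidt decompositions -/

/-- The Schmidt rank of a vector is the rank of its coefficient matrix. -/
theorem schmidtRank_eq_rank {d₁ d₂ : ℕ} (ψ : Fin d₁ × Fin d₂ → ℂ) :
    schmidtRank ψ = (Matrix.of fun i a => ψ (i, a)).rank := by
  rw [schmidtRank, ← rank_self_mul_conjTranspose (Matrix.of fun i a => ψ (i, a))]
  rfl

/-- A vector in `ℂ^l ⊗ ℂ^d` whose component in `ℂ^m ⊗ ℂ^d` is a product vector has Schmidt rank at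
most `l - m + 1`. -/
theorem schmidtRank_le_of_corner_eq_mul {l m d : ℕ} (hm : m ≤ l) (ψ : Fin l × Fin d → ℂ)
    (a : Fin m → ℂ) (b : Fin d → ℂ) (h : ∀ i x, ψ (Fin.castLE hm i, x) = a i * b x) :
    schmidtRank ψ ≤ l - m + 1 := by
  rw [schmidtRank_eq_rank]
  -- The coefficient matrix factors through `ℂ ⊕ ℂ^{l-m}`: its first `m` rows are multiples of `b`.
  let P : Matrix (Fin l) (Unit ⊕ {i : Fin l // ¬ (i : ℕ) < m}) ℂ := Matrix.of fun i =>
    Sum.elim (fun _ => if hi : (i : ℕ) < m then a ⟨i, hi⟩ else 0) fun j => if i = j then 1 else 0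
  let Q : Matrix (Unit ⊕ {i : Fin l // ¬ (i : ℕ) < m}) (Fin d) ℂ := Matrix.of <|
    Sum.elim (fun _ => b) fun j x => ψ (j, x)
  have hPQ : (Matrix.of fun i x => ψ (i, x)) = P * Q := by
    ext i x
    by_cases hi : (i : ℕ) < m
    · have hne : ∀ j : {i : Fin l // ¬ (i : ℕ) < m}, i ≠ j := fun j hj => j.2 (hj ▸ hi)
      simpa [P, Q, Matrix.mul_apply, hi, hne] using h ⟨i, hi⟩ x
    · have : ∀ j : {i : Fin l // ¬ (i : ℕ) < m}, i = j ↔ ⟨i, hi⟩ = j := fun j =>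
        (Subtype.ext_iff (a1 := ⟨i, hi⟩)).symm
      simp [P, Q, Matrix.mul_apply, hi, this]
  have hcard : Fintype.card (Unit ⊕ {i : Fin l // ¬ (i : ℕ) < m}) = l - m + 1 := by
    have : Fintype.card {i : Fin l // (i : ℕ) < m} = m := by
      rw [Fintype.card_congr (Fin.castLEquiv hm).symm, Fintype.card_fin]
    rw [Fintype.card_sum, Fintype.card_subtype_compl, this, Fintype.card_fin, Fintype.card_unit,
      add_comm]
  rw [hPQ, ← hcard]
  exact (rank_mul_le_left P Q).trans (rank_le_card_width P)

theorem exists_eq_mul_of_schmidtRank_le_one {d₁ d₂ : ℕ} {ψ : Fin d₁ × Fin d₂ → ℂ}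
    (h : schmidtRank ψ ≤ 1) : ∃ (a : Fin d₁ → ℂ) (b : Fin d₂ → ℂ), ψ = fun p => a p.1 * b p.2 := by
  rw [schmidtRank_eq_rank, Matrix.rank, finrank_le_one_iff] at h
  obtain ⟨v, hv⟩ := h
  choose c hc using fun j => hv ⟨_, LinearMap.mem_range_self _ (Pi.single j 1)⟩
  refine ⟨v, c, funext fun p => ?_⟩
  have := congrFun (congrArg Subtype.val (hc p.2)) p.1
  simp only [SetLike.val_smul, Pi.smul_apply, smul_eq_mul, mulVecLin_apply, mulVec_single_one,
    col_apply, of_apply] at this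
  rw [mul_comm, this]

theorem HasSchmidtDecomposition.of_fintype {ι : Type*} [Fintype ι] {d₁ d₂ k : ℕ}
    (ψ : ι → Fin d₁ × Fin d₂ → ℂ) (h : ∀ i, schmidtRank (ψ i) ≤ k) :
    HasSchmidtDecomposition k (∑ i, proj (ψ i)) :=
  ⟨_, ψ ∘ (Fintype.equivFin ι).symm, fun _ => h _,
    ((Fintype.equivFin ι).symm.sum_comp fun i => proj (ψ i)).symm⟩

/-- A separable matrix is a finite sum of projectors onto product vectors `a i ⊗ b i`, up to
normalization. -/
theorem IsSeparable.exists_eq_sum_proj {d₁ d₂ : ℕ}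
    {X : Matrix (Fin d₁ × Fin d₂) (Fin d₁ × Fin d₂) ℂ}
    (hX : IsSeparable X) :
    ∃ (ι : Type) (_ : Fintype ι) (a : ι → Fin d₁ → ℂ) (b : ι → Fin d₂ → ℂ),
      X = ∑ i, proj fun p => a i p.1 * b i p.2 := by
  obtain ⟨m, A, B, hA, hB, rfl⟩ := hX
  choose r a ha using fun i => (hA i).exists_eq_sum_proj
  choose s b hb using fun i => (hB i).exists_eq_sum_proj
  refine ⟨Σ i, Fin (r i) × Fin (s i), inferInstance, fun x => a x.1 x.2.1, fun x => b x.1 x.2.2, ?_⟩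
  rw [Fintype.sum_sigma]
  refine Finset.sum_congr rfl fun i _ => ?_
  rw [ha, hb, Fintype.sum_prod_type]
  ext p q
  simp only [kroneckerMap_apply, Matrix.sum_apply, Finset.sum_mul_sum, ← proj_kronecker_proj]

theorem HasSchmidtDecomposition.isSeparable {d₁ d₂ : ℕ}
    {X : Matrix (Fin d₁ × Fin d₂) (Fin d₁ × Fin d₂) ℂ} (hX : HasSchmidtDecomposition 1 X) :
    IsSeparable X := by
  obtain ⟨m, ψ, hψ, rfl⟩ := hX
  choose a b hab using fun i => exists_eq_mul_of_schmidtRank_le_one (hψ i)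
  refine ⟨m, fun i => proj (a i), fun i => proj (b i), fun i => posSemidef_proj _,
    fun i => posSemidef_proj _, Finset.sum_congr rfl fun i _ => ?_⟩
  rw [proj_kronecker_proj, hab]

/-- A positive matrix on `ℂ^l ⊗ ℂ^d` whose corner on `ℂ^m ⊗ ℂ^d` is separable has Schmidt number at
most `l - m + 1`. -/
theorem HasSchmidtDecomposition.of_isSeparable_corner {l m d : ℕ} (hm : m ≤ l)
    {Y : Matrix (Fin l × Fin d) (Fin l × Fin d) ℂ} (hY : Y.PosSemidef)
    (hsep : IsSeparable (Y.submatrix (Prod.map (Fin.castLE hm) id) (Prod.map (Fin.castLE hm) id))) :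
    HasSchmidtDecomposition (l - m + 1) Y := by
  obtain ⟨ι, _, a, b, hab⟩ := hsep.exists_eq_sum_proj
  obtain ⟨w, hw, hpos⟩ := exists_extend_sum_proj hY _ _ hab
  obtain ⟨s, ψ, hψ⟩ := hpos.exists_eq_sum_proj
  have hY' : Y = ∑ i, proj (Sum.elim w ψ i) := by
    rw [Fintype.sum_sum_type]
    simp only [Sum.elim_inl, Sum.elim_inr]
    rw [← hψ, add_sub_cancel]
  rw [hY']
  refine .of_fintype _ ?_
  rintro (i | i)
  · exact schmidtRank_le_of_corner_eq_mul hm _ (a i) (b i) fun j x => hw i (j, x)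
  · refine schmidtRank_le_of_corner_eq_mul hm _ 0 0 fun j x => ?_
    rw [Sum.elim_inr, Pi.zero_apply, Pi.zero_apply, mul_zero]
    refine apply_eq_zero_of_sum_proj_diag_eq_zero ψ ?_ i
    rw [← hψ, Matrix.sub_apply, sub_eq_zero]
    have := congrFun (congrFun hab (j, x)) (j, x)
    simp only [Matrix.sum_apply, proj_apply] at this ⊢
    refine this.trans (Finset.sum_congr rfl fun i _ => ?_)
    rw [← hw i (j, x)]
    rfl

/-! ### Changing the ancilla dimension -/

/-- Applying `T` blockwise commutes with selecting, or repeating, block rows and columns. -/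
theorem idTensor_submatrix {d₁ d₂ l k : ℕ}
    (T : Matrix (Fin d₁) (Fin d₁) ℂ →ₗ[ℂ] Matrix (Fin d₂) (Fin d₂) ℂ) (f : Fin l → Fin k)
    (X : Matrix (Fin k × Fin d₁) (Fin k × Fin d₁) ℂ) :
    idTensor l T (X.submatrix (Prod.map f id) (Prod.map f id)) =
      (idTensor k T X).submatrix (Prod.map f id) (Prod.map f id) := rfl

/-- Every positive matrix on `ℂ^l ⊗ ℂ^d` is a corner of a positive matrix on `ℂ^k ⊗ ℂ^d`, obtained
by repeating one of its block rows and columns. -/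
theorem exists_posSemidef_corner_eq {l k d : ℕ} (h : l ≤ k)
    {X : Matrix (Fin l × Fin d) (Fin l × Fin d) ℂ} (hX : X.PosSemidef) :
    ∃ Z : Matrix (Fin k × Fin d) (Fin k × Fin d) ℂ, Z.PosSemidef ∧
      X = Z.submatrix (Prod.map (Fin.castLE h) id) (Prod.map (Fin.castLE h) id) := by
  rcases Nat.eq_zero_or_pos l with rfl | hl
  · exact ⟨0, .zero, Subsingleton.elim _ _⟩
  · have : Nonempty (Fin l) := ⟨⟨0, hl⟩⟩
    let g := Function.invFun (Fin.castLE h)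
    refine ⟨X.submatrix (Prod.map g id) (Prod.map g id), hX.submatrix _, ?_⟩
    have hg : g ∘ Fin.castLE h = id := Function.invFun_comp (Fin.castLE_injective h)
    rw [submatrix_submatrix, Prod.map_comp_map, hg, Function.id_comp, Prod.map_id, submatrix_id_id]

theorem IsKPositive.mono {d₁ d₂ l k : ℕ}
    {T : Matrix (Fin d₁) (Fin d₁) ℂ →ₗ[ℂ] Matrix (Fin d₂) (Fin d₂) ℂ} (hT : IsKPositive k T)
    (h : l ≤ k) : IsKPositive l T := by
  intro X hX
  obtain ⟨Z, hZ, rfl⟩ := exists_posSemidef_corner_eq h hX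
  rw [idTensor_submatrix]
  exact (hT Z hZ).submatrix _

theorem IsSeparable.submatrix {d₁ d₂ l : ℕ} {X : Matrix (Fin d₁ × Fin d₂) (Fin d₁ × Fin d₂) ℂ}
    (hX : IsSeparable X) (f : Fin l → Fin d₁) :
    IsSeparable (X.submatrix (Prod.map f id) (Prod.map f id)) := by
  obtain ⟨m, A, B, hA, hB, rfl⟩ := hX
  refine ⟨m, fun i => (A i).submatrix f f, B, fun i => (hA i).submatrix f, hB, ?_⟩
  ext p q
  simp [Matrix.sum_apply]

theorem IsEntanglementBreaking.mono {d₁ d₂ m n : ℕ}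
    {T : Matrix (Fin d₁) (Fin d₁) ℂ →ₗ[ℂ] Matrix (Fin d₂) (Fin d₂) ℂ}
    (hT : IsEntanglementBreaking n T) (h : m ≤ n) : IsEntanglementBreaking m T := by
  intro X hX
  obtain ⟨Z, hZ, rfl⟩ := exists_posSemidef_corner_eq h hX
  rw [idTensor_submatrix]
  exact (hT Z hZ).submatrix _

end QInfo

theorem mainTheorem4 (d₁ d₂ k n : ℕ)
    (T : Matrix (Fin d₁) (Fin d₁) ℂ →ₗ[ℂ] Matrix (Fin d₂) (Fin d₂) ℂ)
    (hT : QInfo.IsKPositive k T) (hn : n ≤ min k d₂) :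
    QInfo.IsEntanglementBreaking n T ↔
      ∀ l : ℕ, l ≤ min k d₂ →
        ∀ X : Matrix (Fin l × Fin d₁) (Fin l × Fin d₁) ℂ, X.PosSemidef →
          (QInfo.schmidtNumber (QInfo.idTensor l T X) : ℤ) ≤ max ((l : ℤ) - (n : ℤ) + 1) 1 := by
  constructor
  · intro hEB l hl X hX
    -- The corner of size `min l n` treats `l < n` and `n ≤ l` together.
    have hml : min l n ≤ l := min_le_left l n
    have hY := hT.mono (hl.trans (min_le_left _ _)) X hX
    have hdec : QInfo.HasSchmidtDecomposition (l - min l n + 1) (QInfo.idTensor l T X) := by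
      refine .of_isSeparable_corner hml hY ?_
      rw [← QInfo.idTensor_submatrix]
      exact hEB.mono (min_le_right l n) _ (hX.submatrix _)
    have hSN : QInfo.schmidtNumber (QInfo.idTensor l T X) ≤ l - min l n + 1 :=
      Nat.sInf_le ⟨by omega, hdec⟩
    omega
  · intro h X hX
    obtain ⟨h1, hdec⟩ := QInfo.schmidtNumber_spec (hT.mono (hn.trans (min_le_left _ _)) X hX)
    have hle := h n hn X hX
    have hSN : QInfo.schmidtNumber (QInfo.idTensor n T X) = 1 := by
      simp only [sub_self, zero_add, max_self] at hle
      omega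
    rw [hSN] at hdec
    exact hdec.isSeparable
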